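/- Let $d\ge 0$, let $\eta=\mathrm{diag}(-1,1,\dots,1)$ on $\mathbb{R}^{1,d}$, and let $\mathrm{Spin}(1,d)\to \mathrm{SO}(1,d)$ be the standard double cover. Let $G$ be an abelian Lie group acting smoothly and freely from the right on a smooth manifold $\widetilde X$, with fundamental vector fields $A^\#$, $A\in\mathfrak g=\mathrm{Lie}(G)$. Let $\pi:Q\to\widetilde X$ be a principal $\mathrm{SO}(1,d)$-bundle with a coframe $e: T\widetilde X\xrightarrow{\sim} Q\times_{\mathrm{SO}(1,d)}\mathbb{R}^{1,d}$ (regarded as a smooth horizontal equivariant $\mathbb{R}^{1,d}$-valued $1$-form on $Q$), let $g=\langle e,e\rangle=\eta_{ab}\,e^a\otimes e^b$ be its metric on $\widetilde X$, and let $\Lambda:P\to Q$ be a lift of $Q$ to a principal $\mathrm{Spin}(1,d)$-bundle $P\to \widetilde X$. For a vector field $\xi$ on $\widetilde X$, its Kosmann lift $\xi^K$ is the $\mathrm{SO}(1,d)$-invariant vector field on $Q$ that projects to $\xi$ and satisfies $L_\xi g = 2\langle L^K_\xi e, e\rangle$, where $L^K_\xi e:=L_{\xi^K}e$; it lifts uniquely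 along $\Lambda$ to a vector field on $P$, again denoted $\xi^K$. For a form $\psi$ on $\widetilde X$ valued in the bundle associated to $P$ and a representation of $\mathrm{Spin}(1,d)$ on a finite-dimensional vector space $V$ (a spinor field; regarded as a horizontal equivariant $V$-valued form on $P$) and for a connection $1$-form $\omega$ on $P$ (a spin connection, with values in $\mathfrak{spin}(1,d)\cong\mathfrak{so}(1,d)$), the Kosmann Lie derivatives are the Lie derivatives on $P$: $L^K_\xi\psi:=L_{\xi^K}\psi$ and $L^K_\xi\omega:=L_{\xi^K}\omega$. Suppose that $(e,\psi,\omega)$ is $G$-symmetric, i.e. $$L^K_{A^\#}e=0,\qquad L^K_{A^\#}\psi=0,\qquad L^K_{A^\#}\omega=0\qquad\text{for all }A\in\mathfrak g .$$ Let $\sigma:U\to P$ be a smooth local section of $P\to\widetilde X$ over an open set $U\subseteq\widetilde X$ (a local gauge), and write $\hat e=(\Lambda\circ\sigma)^*e$, $\hat\psi=\sigma^*\psi$, $\hat\omega=\sigma^*\omega$ for the fields in this gauge. If the gauge is adapted, i.e. $L_{A^\#}\hat e=0$ on $U$ for all $A\in\mathfrak g$ (ordinary Lie derivative), then on $U$,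 for all $A\in\mathfrak g$, $$L_{A^\#}\hat\psi=0\qquad\text{and}\qquad L_{A^\#}\hat\omega=0 ,$$ and the covariantization term of the Kosmann lift in this gauge, $B^K_{A^\#}:=\iota_{A^\#}\hat\omega-\sigma^*(\iota_{(A^\#)^K}\,\omega)$, vanishes. -/

import Mathlib

open scoped Manifold ContDiff Topology

noncomputable section

namespace KosmannSymmetry

/-! ### Tensor fields and their Lie derivatives on manifolds without boundary -/

section Calculus

variable (E : Type*) [NormedAddCommGroup E] [NormedSpace ℝ E]
  {E' : Type*} [NormedAddCommGroup E'] [NormedSpace ℝ E']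
  (M : Type*) [TopologicalSpace M] [ChartedSpace E M]
  {M' : Type*} [TopologicalSpace M'] [ChartedSpace E' M']

/-- Vector fields on a manifold `M` modelled on `E`. -/
abbrev VField := ∀ x : M, TangentSpace 𝓘(ℝ, E) x

/-- Covariant tensor fields of rank `k` on `M` with values in the vector space `F`.
Differential `k`-forms are the alternating ones. -/
abbrev TensorField (k : ℕ) (F : Type*) [NormedAddCommGroup F] [NormedSpace ℝ F] :=
  ∀ x : M, ContinuousMultilinearMap ℝ (fun _ : Fin k => TangentSpace 𝓘(ℝ, E) x) F

variable {E M} {k : ℕ} {F : Type*} [NormedAddCommGroup F] [NormedSpace ℝ F]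

/-- A smooth vector field. -/
def IsSmoothVField [IsManifold 𝓘(ℝ, E) ∞ M] (ξ : VField E M) : Prop :=
  ContMDiff 𝓘(ℝ, E) 𝓘(ℝ, E).tangent ∞ (fun x => (⟨x, ξ x⟩ : TangentBundle 𝓘(ℝ, E) M))

/-- The pullback `f^* φ` of a covariant tensor field. -/
def pullback (f : M → M') (φ : TensorField E' M' k F) : TensorField E M k F := fun x =>
  (φ (f x)).compContinuousLinearMap (fun _ => mfderiv 𝓘(ℝ, E) 𝓘(ℝ, E') f x)

/-- The tensor field `φ` read in the preferred chart at `x₀`. -/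
def chartTensor (φ : TensorField E M k F) (x₀ : M) :
    E → ContinuousMultilinearMap ℝ (fun _ : Fin k => E) F :=
  pullback (E := E) (E' := E) (extChartAt 𝓘(ℝ, E) x₀).symm φ

/-- The vector field `ξ` read in the preferred chart at `x₀`. -/
def chartVField (ξ : VField E M) (x₀ : M) : E → E :=
  VectorField.mpullback 𝓘(ℝ, E) 𝓘(ℝ, E) (extChartAt 𝓘(ℝ, E) x₀).symm ξ

/-- A smooth covariant tensor field: all its chart representatives are smooth. -/
def IsSmoothTensor (φ : TensorField E M k F) : Prop :=
  ∀ x₀ : M, ContDiffOn ℝ ∞ (chartTensor φ x₀) (extChartAt 𝓘(ℝ, E) x₀).target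

/-- The Lie derivative in a vector space:
`(L_ξ φ)(v₁,…,v_k) = (Dφ · ξ)(v₁,…,v_k) + ∑ᵢ φ(v₁,…,Dξ · vᵢ,…,v_k)`. -/
def lieDerivFlat (ξ : E → E) (φ : E → ContinuousMultilinearMap ℝ (fun _ : Fin k => E) F) (y : E) :
    ContinuousMultilinearMap ℝ (fun _ : Fin k => E) F :=
  fderiv ℝ φ y (ξ y) + ∑ i : Fin k, (φ y).compContinuousLinearMap
    (Function.update (fun _ => ContinuousLinearMap.id ℝ E) i (fderiv ℝ ξ y))

/-- The Lie derivative `L_ξ φ` of a covariant tensor field, computed at `x₀` in the preferred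
chart there. -/
def lieDeriv (ξ : VField E M) (φ : TensorField E M k F) : TensorField E M k F := fun x₀ =>
  (lieDerivFlat (chartVField ξ x₀) (chartTensor φ x₀)
      (extChartAt 𝓘(ℝ, E) x₀ x₀)).compContinuousLinearMap
    (fun _ => (mfderiv 𝓘(ℝ, E) 𝓘(ℝ, E) (extChartAt 𝓘(ℝ, E) x₀) x₀ :
      TangentSpace 𝓘(ℝ, E) x₀ →L[ℝ] E))

end Calculus

/-! ### The groups `SO(1,d)` and `Spin(1,d)` -/

/-- The vector space `ℝ^{1,d}`. -/
abbrev Mink (d : ℕ) : Type := Fin (d + 1) → ℝ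

/-- The Lorentzian form `η = diag(-1, 1, …, 1)`. -/
def eta (d : ℕ) : LinearMap.BilinForm ℝ (Mink d) :=
  Matrix.toBilin' (Matrix.diagonal fun i => if i = 0 then -1 else 1)

/-- The quadratic form `v ↦ η(v, v)`. -/
abbrev lorentzQ (d : ℕ) : QuadraticForm ℝ (Mink d) := (eta d).toQuadraticMap

/-- `SO(1,d)`: the linear automorphisms of `ℝ^{1,d}` that preserve `η` and have determinant one. -/
def SO (d : ℕ) : Subgroup (Mink d ≃L[ℝ] Mink d) where
  carrier := {A | (∀ v w, eta d (A v) (A w) = eta d v w) ∧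
    LinearMap.det (A.toLinearEquiv : Mink d →ₗ[ℝ] Mink d) = 1}
  one_mem' := ⟨fun _ _ => rfl, LinearMap.det_id⟩
  mul_mem' := by
    rintro A B ⟨hA, hA'⟩ ⟨hB, hB'⟩
    refine ⟨fun v w => (hA _ _).trans (hB v w), ?_⟩
    have h : (((A * B).toLinearEquiv : Mink d ≃ₗ[ℝ] Mink d) : Mink d →ₗ[ℝ] Mink d) =
      (A.toLinearEquiv : Mink d →ₗ[ℝ] Mink d) ∘ₗ (B.toLinearEquiv : Mink d →ₗ[ℝ] Mink d) := rfl
    rw [h, LinearMap.det_comp, hA', hB', one_mul]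
  inv_mem' := by
    rintro A ⟨hA, hA'⟩
    refine ⟨fun v w => ?_, ?_⟩
    · have h := hA (A.symm v) (A.symm w)
      rw [A.apply_symm_apply, A.apply_symm_apply] at h
      exact h.symm
    · have h : LinearMap.det ((A.toLinearEquiv : Mink d →ₗ[ℝ] Mink d) ∘ₗ
          ((A⁻¹).toLinearEquiv : Mink d →ₗ[ℝ] Mink d)) = 1 := by
        rw [← LinearMap.det_id (A := ℝ) (M := Mink d)]
        congr 1
        refine LinearMap.ext fun v => ?_
        exact A.apply_symm_apply _
      rwa [LinearMap.det_comp, hA', one_mul] at h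

/-- An element of `SO(1,d)` as an endomorphism of `ℝ^{1,d}`. -/
def toEnd {d : ℕ} (A : SO d) : Mink d →L[ℝ] Mink d := (A : Mink d ≃L[ℝ] Mink d)

/-- The canonical topology of the (finite-dimensional) Clifford algebra. -/
instance cliffordTopology (d : ℕ) : TopologicalSpace (CliffordAlgebra (lorentzQ d)) :=
  moduleTopology ℝ _

/-- `Spin(1,d)`: the products of an even number of vectors of `ℝ^{1,d}` of square `±1`, i.e. the
even elements `x` of the Lipschitz group with `x̄ x = ±1`, where `x̄` is the Clifford conjugate. -/
def Spin (d : ℕ) : Subgroup (CliffordAlgebra (lorentzQ d))ˣ where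
  carrier := {x | x ∈ lipschitzGroup (lorentzQ d) ∧
    (x : CliffordAlgebra (lorentzQ d)) ∈ CliffordAlgebra.even (lorentzQ d) ∧
    (star (x : CliffordAlgebra (lorentzQ d)) * x = 1 ∨
      star (x : CliffordAlgebra (lorentzQ d)) * x = -1)}
  one_mem' := ⟨one_mem _, one_mem _, Or.inl (by simp)⟩
  mul_mem' := by
    rintro x y ⟨hx, hx', hx''⟩ ⟨hy, hy', hy''⟩
    refine ⟨mul_mem hx hy, mul_mem hx' hy', ?_⟩
    have h : star ((x * y : (CliffordAlgebra (lorentzQ d))ˣ) : CliffordAlgebra (lorentzQ d)) *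
        (x * y : (CliffordAlgebra (lorentzQ d))ˣ) =
        star (y : CliffordAlgebra (lorentzQ d)) * (star (x : CliffordAlgebra (lorentzQ d)) * x) *
          y := by
      simp only [Units.val_mul, star_mul, mul_assoc]
    rw [h]
    rcases hx'' with e | e <;> rcases hy'' with e' | e' <;> simp [e, e']
  inv_mem' := by
    rintro x ⟨hx, hx', hx''⟩
    have key : ∀ ε : CliffordAlgebra (lorentzQ d), ε * ε = 1 →
        star (x : CliffordAlgebra (lorentzQ d)) * x = ε →
        ((x⁻¹ : (CliffordAlgebra (lorentzQ d))ˣ) : CliffordAlgebra (lorentzQ d)) =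
          ε * star (x : CliffordAlgebra (lorentzQ d)) := by
      intro ε hε h
      rw [Units.inv_eq_of_mul_eq_one_left]
      rw [mul_assoc, h, hε]
    have hst : star (x : CliffordAlgebra (lorentzQ d)) ∈ CliffordAlgebra.even (lorentzQ d) := by
      rw [CliffordAlgebra.star_def]
      have h1 : CliffordAlgebra.involute (x : CliffordAlgebra (lorentzQ d)) = x :=
        CliffordAlgebra.involute_eq_of_mem_even hx'
      rw [h1]
      exact (CliffordAlgebra.reverse_mem_evenOdd_iff (Q := lorentzQ d) (n := 0)).2 hx'
    have hu : ∀ ε : CliffordAlgebra (lorentzQ d), ε * ε = 1 → (∀ z, ε * z = z * ε) →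
        star ε = ε → star (x : CliffordAlgebra (lorentzQ d)) * x = ε →
        star ((x⁻¹ : (CliffordAlgebra (lorentzQ d))ˣ) : CliffordAlgebra (lorentzQ d)) *
          ((x⁻¹ : (CliffordAlgebra (lorentzQ d))ˣ) : CliffordAlgebra (lorentzQ d)) = ε := by
      intro ε hε hc hs h
      have h2 := key ε hε h
      nth_rewrite 1 [h2]
      rw [star_mul, star_star, hs, ← hc, mul_assoc, Units.mul_inv, mul_one]
    rcases hx'' with e | e
    · exact ⟨inv_mem hx, by rw [key 1 (by simp) e, one_mul]; exact hst,
        Or.inl (hu 1 (by simp) (by simp) (by simp) e)⟩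
    · exact ⟨inv_mem hx, by rw [key (-1) (by simp) e, neg_one_mul]; exact neg_mem hst,
        Or.inr (hu (-1) (by simp) (by simp) (by simp) e)⟩

/-- The double cover `Spin(1,d) → SO(1,d)` as a relation: `A` is the image of `s`, i.e.
`A v = s v s⁻¹` in the Clifford algebra. -/
def Covers {d : ℕ} (s : Spin d) (A : SO d) : Prop :=
  ∀ v : Mink d, CliffordAlgebra.ι (lorentzQ d) (toEnd A v) =
    ((s : (CliffordAlgebra (lorentzQ d))ˣ) : CliffordAlgebra (lorentzQ d)) *
      CliffordAlgebra.ι (lorentzQ d) v *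
      (((s : (CliffordAlgebra (lorentzQ d))ˣ)⁻¹ : (CliffordAlgebra (lorentzQ d))ˣ) :
        CliffordAlgebra (lorentzQ d))

/-- The right action of `s` on `p`, for a group acting from the right. -/
def rmul {S P : Type*} [Monoid S] [MulAction Sᵐᵒᵖ P] (s : S) (p : P) : P := MulOpposite.op s • p

/-! ### Principal bundles, coframes, spinor fields, connections -/

section Bundles

variable {d : ℕ}
  {EX X : Type*} [NormedAddCommGroup EX] [NormedSpace ℝ EX]
  [TopologicalSpace X] [ChartedSpace EX X]
  {EQ Q : Type*} [NormedAddCommGroup EQ] [NormedSpace ℝ EQ]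
  [TopologicalSpace Q] [ChartedSpace EQ Q] [IsManifold 𝓘(ℝ, EQ) ∞ Q] [MulAction (SO d)ᵐᵒᵖ Q]
  {EP P : Type*} [NormedAddCommGroup EP] [NormedSpace ℝ EP]
  [TopologicalSpace P] [ChartedSpace EP P] [MulAction (Spin d)ᵐᵒᵖ P]

variable (d EX EQ) in
/-- `π : Q → X` is a smooth principal `SO(1,d)`-bundle. Over small open sets `U` there are
equivariant trivializations `(π, h) : π⁻¹(U) ≅ U × SO(1,d)`; that this is a diffeomorphism is
expressed through the closed embedded submanifold `SO(1,d) ⊂ End(ℝ^{1,d})`: `(π, h)` is a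
smooth immersion and a homeomorphism onto `U × SO(1,d)`. -/
structure IsPrincipalSOBundle (π : Q → X) : Prop where
  smooth_proj : ContMDiff 𝓘(ℝ, EQ) 𝓘(ℝ, EX) ∞ π
  smooth_rmul : ∀ s : SO d, ContMDiff 𝓘(ℝ, EQ) 𝓘(ℝ, EQ) ∞ (rmul s : Q → Q)
  proj_rmul : ∀ (s : SO d) (q : Q), π (rmul s q) = π q
  locally_trivial : ∀ x : X, ∃ U : Set X, IsOpen U ∧ x ∈ U ∧ ∃ h : Q → SO d,
    (∀ q, π q ∈ U → ∀ s : SO d, h (rmul s q) = h q * s) ∧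
    ContMDiffOn 𝓘(ℝ, EQ) 𝓘(ℝ, Mink d →L[ℝ] Mink d) ∞ (fun q => toEnd (h q)) (π ⁻¹' U) ∧
    (∀ q, π q ∈ U → ∀ v : TangentSpace 𝓘(ℝ, EQ) q, mfderiv 𝓘(ℝ, EQ) 𝓘(ℝ, EX) π q v = 0 →
      mfderiv 𝓘(ℝ, EQ) 𝓘(ℝ, Mink d →L[ℝ] Mink d) (fun q => toEnd (h q)) q v = 0 → v = 0) ∧
    Topology.IsEmbedding (fun q : π ⁻¹' U => (π q, toEnd (h q))) ∧
    (∀ y ∈ U, ∀ s : SO d, ∃ q, π q = y ∧ h q = s)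

variable (d EQ EP) in
/-- `Λ : P → Q` is a lift of the principal `SO(1,d)`-bundle `π : Q → X` to a principal
`Spin(1,d)`-bundle `π ∘ Λ : P → X`: a surjective local diffeomorphism that is equivariant with
respect to the double cover `Spin(1,d) → SO(1,d)`, where `Spin(1,d)` acts continuously on `P` and
simply transitively on the fibres of `π ∘ Λ`. -/
structure IsSpinLift (π : Q → X) (Λ : P → Q) : Prop where
  localDiffeo : IsLocalDiffeomorph 𝓘(ℝ, EP) 𝓘(ℝ, EQ) ∞ Λ
  surjective : Function.Surjective Λ
  equivariant : ∀ s : Spin d, ∃ A : SO d, Covers s A ∧ ∀ p, Λ (rmul s p) = rmul A (Λ p)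
  continuous_rmul : Continuous (fun a : Spin d × P => rmul a.1 a.2)
  simply_transitive : ∀ p p' : P, π (Λ p) = π (Λ p') → ∃! s : Spin d, p' = rmul s p

/-- A coframe `e : TX ≅ Q ×_{SO(1,d)} ℝ^{1,d}`, seen on the total space `Q` as a smooth,
horizontal, equivariant one-form with values in `ℝ^{1,d}` which induces isomorphisms
`T_{π q} X ≅ ℝ^{1,d}`. -/
structure IsCoframe (π : Q → X) (e : TensorField EQ Q 1 (Mink d)) : Prop where
  smooth : IsSmoothTensor e
  equivariant : ∀ (s : SO d) (q : Q) (v : TangentSpace 𝓘(ℝ, EQ) q),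
    e (rmul s q) ![mfderiv 𝓘(ℝ, EQ) 𝓘(ℝ, EQ) (rmul s) q v] = toEnd s⁻¹ (e q ![v])
  ker_eq : ∀ (q : Q) (v : TangentSpace 𝓘(ℝ, EQ) q),
    e q ![v] = 0 ↔ mfderiv 𝓘(ℝ, EQ) 𝓘(ℝ, EX) π q v = 0
  surjective : ∀ (q : Q) (a : Mink d), ∃ v : TangentSpace 𝓘(ℝ, EQ) q, e q ![v] = a

/-- `g = ⟨e, e⟩ = η_{ab} e^a ⊗ e^b`: the metric tensor on `X` of the coframe `e`. -/
def IsMetricOf (π : Q → X) (e : TensorField EQ Q 1 (Mink d)) (g : TensorField EX X 2 ℝ) : Prop :=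
  ∀ (q : Q) (v w : TangentSpace 𝓘(ℝ, EQ) q),
    g (π q) ![mfderiv 𝓘(ℝ, EQ) 𝓘(ℝ, EX) π q v, mfderiv 𝓘(ℝ, EQ) 𝓘(ℝ, EX) π q w] =
      eta d (e q ![v]) (e q ![w])

/-- The Kosmann lift of the vector field `ξ` on `X`: the smooth `SO(1,d)`-invariant vector field
`Z` on `Q` which projects to `ξ` and whose covariant Lie derivative `L^K_ξ e = L_Z e` of the
coframe satisfies `L_ξ g = 2 ⟨L^K_ξ e, e⟩`. These conditions determine `Z`. -/
structure IsKosmannLift (π : Q → X) (e : TensorField EQ Q 1 (Mink d)) (g : TensorField EX X 2 ℝ)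
    (ξ : VField EX X) (Z : VField EQ Q) : Prop where
  smooth : IsSmoothVField Z
  invariant : ∀ (s : SO d) (q : Q), mfderiv 𝓘(ℝ, EQ) 𝓘(ℝ, EQ) (rmul s) q (Z q) = Z (rmul s q)
  proj : ∀ q, mfderiv 𝓘(ℝ, EQ) 𝓘(ℝ, EX) π q (Z q) = ξ (π q)
  kosmann : ∀ (q : Q) (v w : TangentSpace 𝓘(ℝ, EQ) q),
    lieDeriv ξ g (π q)
        ![mfderiv 𝓘(ℝ, EQ) 𝓘(ℝ, EX) π q v, mfderiv 𝓘(ℝ, EQ) 𝓘(ℝ, EX) π q w] =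
      2 * eta d (lieDeriv Z e q ![v]) (e q ![w])

/-- The lift to `P` of a vector field on `Q` along the covering `Λ : P → Q`. -/
def spinLift (Λ : P → Q) (Z : VField EQ Q) : VField EP P :=
  VectorField.mpullback 𝓘(ℝ, EP) 𝓘(ℝ, EQ) Λ Z

/-- `L^K_ξ e = χ`: the Kosmann Lie derivative of the coframe along `ξ`, on the total space `Q`. -/
def HasKosmannLieDerivCoframe (π : Q → X) (e : TensorField EQ Q 1 (Mink d))
    (g : TensorField EX X 2 ℝ) (ξ : VField EX X) (χ : TensorField EQ Q 1 (Mink d)) : Prop :=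
  ∃ Z : VField EQ Q, IsKosmannLift π e g ξ Z ∧ ∀ q, lieDeriv Z e q = χ q

/-- `L^K_ξ φ = χ`: the Kosmann Lie derivative along `ξ` of a field `φ` (a matter field or a
connection) given on the total space `P` of the spin bundle, i.e. its Lie derivative along the
lift to `P` of the Kosmann lift of `ξ`. -/
def HasKosmannLieDeriv (π : Q → X) (e : TensorField EQ Q 1 (Mink d)) (g : TensorField EX X 2 ℝ)
    (Λ : P → Q) {k : ℕ} {F : Type*} [NormedAddCommGroup F] [NormedSpace ℝ F]
    (ξ : VField EX X) (φ χ : TensorField EP P k F) : Prop :=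
  ∃ Z : VField EQ Q, IsKosmannLift π e g ξ Z ∧ ∀ p, lieDeriv (spinLift Λ Z) φ p = χ p

/-- A `k`-form on `X` with values in the bundle `P ×_{Spin(1,d)} V` associated with the
representation `τ`, seen on the total space `P` as a smooth, horizontal, equivariant `k`-form with
values in `V`. -/
structure IsSpinorForm (π : Q → X) (Λ : P → Q) {V : Type*} [NormedAddCommGroup V]
    [NormedSpace ℝ V] (τ : Representation ℝ (Spin d) V) {k : ℕ} (ψ : TensorField EP P k V) :
    Prop where
  smooth : IsSmoothTensor ψ
  alternating : ∀ (p : P) (v : Fin k → TangentSpace 𝓘(ℝ, EP) p) (i j : Fin k),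
    v i = v j → i ≠ j → ψ p v = 0
  horizontal : ∀ (p : P) (v : Fin k → TangentSpace 𝓘(ℝ, EP) p) (i : Fin k),
    mfderiv 𝓘(ℝ, EP) 𝓘(ℝ, EX) (π ∘ Λ) p (v i) = 0 → ψ p v = 0
  equivariant : ∀ (s : Spin d) (p : P) (v : Fin k → TangentSpace 𝓘(ℝ, EP) p),
    ψ (rmul s p) (fun i => mfderiv 𝓘(ℝ, EP) 𝓘(ℝ, EP) (rmul s) p (v i)) = τ s⁻¹ (ψ p v)

/-- A spin connection: a connection form on `P`, with values in
`𝔰𝔬(1,d) ≅ 𝔰𝔭𝔦𝔫(1,d)`. The vertical vector `B^#` at `p` is the one that `Λ` maps to the velocity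
of `t ↦ Λ(p) · s(t)`, where `s` is a curve in `SO(1,d)` through `1` with velocity `B`. -/
structure IsSpinConnection (Λ : P → Q)
    (conn : TensorField EP P 1 (Mink d →L[ℝ] Mink d)) : Prop where
  smooth : IsSmoothTensor conn
  skew : ∀ (p : P) (v : TangentSpace 𝓘(ℝ, EP) p) (a b : Mink d),
    eta d (conn p ![v] a) b + eta d a (conn p ![v] b) = 0
  equivariant : ∀ (s : Spin d) (A : SO d), Covers s A →
    ∀ (p : P) (v : TangentSpace 𝓘(ℝ, EP) p),
      conn (rmul s p) ![mfderiv 𝓘(ℝ, EP) 𝓘(ℝ, EP) (rmul s) p v] =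
        toEnd A⁻¹ ∘L conn p ![v] ∘L toEnd A
  fundamental : ∀ (s : ℝ → SO d) (B : Mink d →L[ℝ] Mink d),
    ContDiff ℝ ∞ (fun t => toEnd (s t)) → s 0 = 1 → HasDerivAt (fun t => toEnd (s t)) B 0 →
    ∀ (p : P) (v : TangentSpace 𝓘(ℝ, EP) p),
      HasMFDerivAt 𝓘(ℝ, ℝ) 𝓘(ℝ, EQ) (fun t => rmul (s t) (Λ p)) 0
        (ContinuousLinearMap.toSpanSingleton ℝ (mfderiv 𝓘(ℝ, EP) 𝓘(ℝ, EQ) Λ p v)) →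
      conn p ![v] = B

variable (EX EP) in
/-- A local gauge over the open set `U ⊆ X`: a smooth section `σ` of the spin bundle over `U`.
In this gauge the fields are represented by `(Λ ∘ σ)^* e`, `σ^* ψ`, `σ^* ω`; the gauge
transformations are the changes of section. -/
structure IsLocalGauge (π : Q → X) (Λ : P → Q) (U : Set X) (σ : X → P) : Prop where
  isOpen : IsOpen U
  smooth : ContMDiffOn 𝓘(ℝ, EX) 𝓘(ℝ, EP) ∞ σ U
  proj : ∀ x ∈ U, π (Λ (σ x)) = x

/-- The covariantization term `B_ξ = ι_ξ ω - λ_ξ` of a lift `Z` of `ξ`, in the local gauge `σ`;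
here `λ_ξ = ι_Z ω`. -/
def correctionTerm (Λ : P → Q) (conn : TensorField EP P 1 (Mink d →L[ℝ] Mink d)) (ξ : VField EX X)
    (Z : VField EQ Q) (σ : X → P) (x : X) : Mink d →L[ℝ] Mink d :=
  pullback σ conn x ![ξ x] - conn (σ x) ![spinLift (EP := EP) Λ Z (σ x)]

end Bundles

/-- The fundamental vector field `A^#` on `X` of a right `G`-action, `A ∈ Lie(G)`:
`A^#_x` is the derivative of `g ↦ x · g` at `1` in the direction `A`. -/
def fundamentalVField {EG G : Type*} [NormedAddCommGroup EG] [NormedSpace ℝ EG]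
    [TopologicalSpace G] [ChartedSpace EG G] [Group G]
    (EX X : Type*) [NormedAddCommGroup EX] [NormedSpace ℝ EX]
    [TopologicalSpace X] [ChartedSpace EX X] [MulAction Gᵐᵒᵖ X] (A : GroupLieAlgebra 𝓘(ℝ, EG) G) :
    VField EX X := fun x =>
  mfderiv 𝓘(ℝ, EG) 𝓘(ℝ, EX) (fun g : G => (rmul g x : X)) 1 A

end KosmannSymmetry

end

/-! ### Lie derivatives in a normed space: naturality and the product rule. -/

namespace KosmannSymmetry

section FlatCalculus

variable {E : Type*} [NormedAddCommGroup E] [NormedSpace ℝ E]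
  {E' : Type*} [NormedAddCommGroup E'] [NormedSpace ℝ E']
  {k : ℕ} {F : Type*} [NormedAddCommGroup F] [NormedSpace ℝ F]
  {F' : Type*} [NormedAddCommGroup F'] [NormedSpace ℝ F']

/-! The heart of the matter is that an adapted gauge `σ` carries the vector field `ξ = A^#` to its
Kosmann lift: `dσ(ξ) = ξ^K ∘ σ`. Naturality of the Lie derivative then turns `L_{ξ^K} ψ = 0` and
`L_{ξ^K} ω = 0` into the vanishing of `L_ξ σ^*ψ` and `L_ξ σ^*ω`, and the covariantization term is
`ω` applied to `dσ(ξ) - ξ^K`, which is zero.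

Put `f = Λ ∘ σ` and let `Z` be a Kosmann lift of `ξ` to `Q`. Since `L^K_ξ e = 0`, the Kosmann
condition and nondegeneracy of `η` give `L_Z e = 0` (`IsKosmannLift.lieDeriv_coframe_eq_zero`). In a
local trivialization with `SO(1,d)`-component `H`, equivariance and horizontality of `e` give `H · e
= (H ∘ f ∘ π) · π^*f^*e`. Now apply `L_Z`. Both `L_Z e` and `L_Z π^*f^*e = π^*(L_ξ f^*e)` vanish, so
only derivatives of the matrix factors survive; because `e` is onto `ℝ^{1,d}` at `f x`, they agree:
`dH(Z) = dH(df(ξ))`. As `Z` and `df(ξ)` both project to `ξ` and `(π, H)` is an immersion, they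
coincide (`mfderiv_section_eq`). The local diffeomorphism `Λ` transfers this to `σ`
(`mfderiv_eq_spinLift`).

The analytic tools are naturality under related vector fields (`lieDeriv_pullback`) and the product
rule (`lieDeriv_comp`), both proved in a normed space and moved to manifolds through charts. -/

lemma lieDerivFlat_apply (ξ : E → E) (φ : E → ContinuousMultilinearMap ℝ (fun _ : Fin k => E) F)
    (y : E) (v : Fin k → E) :
    lieDerivFlat ξ φ y v = fderiv ℝ φ y (ξ y) v +
      ∑ i : Fin k, φ y (Function.update v i (fderiv ℝ ξ y (v i))) := by
  simp only [lieDerivFlat, add_apply, sum_apply,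
    ContinuousMultilinearMap.compContinuousLinearMap_apply]
  congr 1
  refine Finset.sum_congr rfl fun i _ => ?_
  congr 1
  ext j
  by_cases h : j = i
  · subst h; simp
  · simp [h]

/-- Naturality of the Lie derivative under a map which relates the vector fields `ξ` and `Z`. -/
lemma lieDerivFlat_pullback {f : E → E'}
    {φ : E' → ContinuousMultilinearMap ℝ (fun _ : Fin k => E') F} {ξ : E → E} {Z : E' → E'} {y : E}
    (hf : ContDiffAt ℝ 2 f y) (hφ : DifferentiableAt ℝ φ (f y)) (hξ : DifferentiableAt ℝ ξ y)
    (hZ : DifferentiableAt ℝ Z (f y))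
    (hrel : ∀ᶠ z in 𝓝 y, fderiv ℝ f z (ξ z) = Z (f z)) :
    lieDerivFlat ξ (fun z => (φ (f z)).compContinuousLinearMap fun _ => fderiv ℝ f z) y =
      (lieDerivFlat Z φ (f y)).compContinuousLinearMap fun _ => fderiv ℝ f y := by
  have hf1 : DifferentiableAt ℝ f y := hf.differentiableAt (by norm_num)
  have hf2 : DifferentiableAt ℝ (fderiv ℝ f) y :=
    (hf.fderiv_right (m := 1) (by norm_num)).differentiableAt (by norm_num)
  have hsymm : IsSymmSndFDerivAt ℝ f y := hf.isSymmSndFDerivAt (by simp)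
  -- Differentiate `Df · ξ = Z ∘ f` in the direction `w`. This produces `D²f(w, ξ)`, whereas
  -- differentiating the pullback along `ξ` produces `D²f(ξ, w)`; symmetry of the second derivative
  -- reconciles them.
  have hd : ∀ w, fderiv ℝ (fderiv ℝ f) y (ξ y) w + fderiv ℝ f y (fderiv ℝ ξ y w) =
      fderiv ℝ Z (f y) (fderiv ℝ f y w) := by
    intro w
    have h1 := (hf2.hasFDerivAt.clm_apply hξ.hasFDerivAt).congr_of_eventuallyEq
      (hrel.mono fun _ h => h.symm)
    have h2 := hZ.hasFDerivAt.comp y hf1.hasFDerivAt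
    have h3 := DFunLike.congr_fun (h1.unique h2) w
    simp only [add_apply, ContinuousLinearMap.comp_apply,
      ContinuousLinearMap.flip_apply] at h3
    rw [hsymm (ξ y) w, add_comm]
    exact h3
  have hD := ((hφ.hasFDerivAt.comp y hf1.hasFDerivAt).continuousMultilinearMapCompContinuousLinearMap
    (g := fun _ : Fin k => fderiv ℝ f) (fun _ => hf2.hasFDerivAt)).fderiv
  ext v
  rw [lieDerivFlat_apply]
  simp only [Function.comp_def] at hD
  rw [hD]
  simp only [ContinuousMultilinearMap.compContinuousLinearMap_apply, lieDerivFlat_apply,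
    add_apply, ContinuousLinearMap.comp_apply, hrel.self_of_nhds]
  rw [add_assoc]
  congr 1
  -- What remains is a comparison slot by slot: the `D²f(ξ, vᵢ)` term from the product rule and the
  -- `Df(Dξ vᵢ)` term from the Lie derivative add up to `DZ(Df vᵢ)`, by `hd`.
  rw [ContinuousMultilinearMap.fderivCompContinuousLinearMap_apply, ← Finset.sum_add_distrib]
  refine Finset.sum_congr rfl fun i _ => ?_
  have h1 : (fun j => Function.update (fun _ : Fin k => fderiv ℝ f y) i
      (fderiv ℝ (fderiv ℝ f) y (ξ y)) j (v j)) =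
      Function.update (fun j => fderiv ℝ f y (v j)) i (fderiv ℝ (fderiv ℝ f) y (ξ y) (v i)) := by
    ext1 j
    by_cases h : j = i
    · subst h; simp
    · simp [h]
  have h2 : (fun j => fderiv ℝ f y (Function.update v i (fderiv ℝ ξ y (v i)) j)) =
      Function.update (fun j => fderiv ℝ f y (v j)) i (fderiv ℝ f y (fderiv ℝ ξ y (v i))) := by
    ext1 j
    by_cases h : j = i
    · subst h; simp
    · simp [h]
  rw [← hd, ContinuousMultilinearMap.map_update_add, ← h1, ← h2]
  rfl

lemma lieDerivFlat_congr {ξ : E → E}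
    {φ φ' : E → ContinuousMultilinearMap ℝ (fun _ : Fin k => E) F} {y : E} (h : φ =ᶠ[𝓝 y] φ') :
    lieDerivFlat ξ φ y = lieDerivFlat ξ φ' y := by
  simp only [lieDerivFlat, h.fderiv_eq, h.self_of_nhds]

/-- The product rule for the Lie derivative of `z ↦ H z ∘ φ z`. -/
lemma lieDerivFlat_comp {H : E → F →L[ℝ] F'}
    {φ : E → ContinuousMultilinearMap ℝ (fun _ : Fin k => E) F} {ξ : E → E} {y : E}
    (hH : DifferentiableAt ℝ H y) (hφ : DifferentiableAt ℝ φ y) (v : Fin k → E) :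
    lieDerivFlat ξ (fun z => (H z).compContinuousMultilinearMap (φ z)) y v =
      fderiv ℝ H y (ξ y) (φ y v) + H y (lieDerivFlat ξ φ y v) := by
  have h := ((ContinuousLinearMap.compContinuousMultilinearMapL ℝ (fun _ : Fin k => E) F
    F').hasFDerivAt_of_bilinear hH.hasFDerivAt hφ.hasFDerivAt).fderiv
  have h' : fderiv ℝ (fun z => (H z).compContinuousMultilinearMap (φ z)) y (ξ y) v =
      fderiv ℝ H y (ξ y) (φ y v) + H y (fderiv ℝ φ y (ξ y) v) := by
    rw [add_comm]
    exact congrArg (fun T : E →L[ℝ] ContinuousMultilinearMap ℝ (fun _ : Fin k => E) F' =>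
      T (ξ y) v) h
  rw [lieDerivFlat_apply, lieDerivFlat_apply, h', map_add, map_sum, add_assoc]
  rfl

end FlatCalculus
end KosmannSymmetry

/-! ### Transfer to manifolds through the preferred charts. -/

namespace KosmannSymmetry

section ManifoldCalculus

variable {E : Type*} [NormedAddCommGroup E] [NormedSpace ℝ E]
  {E' : Type*} [NormedAddCommGroup E'] [NormedSpace ℝ E']
  {M : Type*} [TopologicalSpace M] [ChartedSpace E M]
  {M' : Type*} [TopologicalSpace M'] [ChartedSpace E' M']
  {k : ℕ} {F : Type*} [NormedAddCommGroup F] [NormedSpace ℝ F]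
  {F' : Type*} [NormedAddCommGroup F'] [NormedSpace ℝ F']

/-- The differential of the preferred chart at `x₀`. -/
noncomputable def chartDeriv (x₀ x : M) : TangentSpace 𝓘(ℝ, E) x →L[ℝ] E :=
  mfderiv 𝓘(ℝ, E) 𝓘(ℝ, E) (extChartAt 𝓘(ℝ, E) x₀) x

lemma lieDeriv_apply (ξ : VField E M) (φ : TensorField E M k F) (x : M)
    (v : Fin k → TangentSpace 𝓘(ℝ, E) x) :
    lieDeriv ξ φ x v = lieDerivFlat (chartVField ξ x) (chartTensor φ x) (extChartAt 𝓘(ℝ, E) x x)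
      (fun i => chartDeriv x x (v i)) := rfl

/-- Without boundary, the chart maps neighbourhoods of `x` onto neighbourhoods of its image.
Identities between chart representatives can therefore be checked at points of the manifold. -/
lemma eventually_nhds_extChartAt {x : M} {p : E → Prop}
    (h : ∀ᶠ z in 𝓝 x, p (extChartAt 𝓘(ℝ, E) x z)) : ∀ᶠ y in 𝓝 (extChartAt 𝓘(ℝ, E) x x), p y := by
  rw [← map_extChartAt_nhds_of_boundaryless]
  exact h

/-- The vector field `ξ` is differentiable at `x`. -/
def DifferentiableVFieldAt (ξ : VField E M) (x : M) : Prop :=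
  DifferentiableAt ℝ (chartVField ξ x) (extChartAt 𝓘(ℝ, E) x x)

/-- The tensor field `φ` is differentiable at `x`. -/
def DifferentiableTensorAt (φ : TensorField E M k F) (x : M) : Prop :=
  DifferentiableAt ℝ (chartTensor φ x) (extChartAt 𝓘(ℝ, E) x x)

lemma IsSmoothTensor.differentiableTensorAt {φ : TensorField E M k F} (hφ : IsSmoothTensor φ)
    (x : M) : DifferentiableTensorAt φ x :=
  ((hφ x).contDiffAt (extChartAt_target_mem_nhds x)).differentiableAt (by simp)

lemma contDiffAt_writtenInExtChartAt {f : M → M'} {x : M}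
    (hf : ContMDiffAt 𝓘(ℝ, E) 𝓘(ℝ, E') ∞ f x) :
    ContDiffAt ℝ ∞ (writtenInExtChartAt 𝓘(ℝ, E) 𝓘(ℝ, E') x f) (extChartAt 𝓘(ℝ, E) x x) := by
  have h := (contMDiffAt_iff.1 hf).2
  rwa [modelWithCornersSelf_coe, Set.range_id, contDiffWithinAt_univ] at h

variable [IsManifold 𝓘(ℝ, E) ∞ M]

lemma mfderiv_extChartAt_symm_chartDeriv {x₀ x : M} (hx : x ∈ (extChartAt 𝓘(ℝ, E) x₀).source)
    (v : TangentSpace 𝓘(ℝ, E) x) :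
    (mfderiv 𝓘(ℝ, E) 𝓘(ℝ, E) (extChartAt 𝓘(ℝ, E) x₀).symm (extChartAt 𝓘(ℝ, E) x₀ x) :
      E →L[ℝ] E)
      (chartDeriv (E := E) x₀ x v) = v := by
  have : IsManifold 𝓘(ℝ, E) 1 M := .of_le (n := ∞) (by simp)
  have h := mfderivWithin_extChartAt_symm_comp_mfderiv_extChartAt' (I := 𝓘(ℝ, E)) hx
  rw [modelWithCornersSelf_coe, Set.range_id, mfderivWithin_univ] at h
  exact DFunLike.congr_fun h v

/-- Every model vector comes from a tangent vector, so coordinate identities need only be tested on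
images under `chartDeriv`. -/
lemma chartDeriv_surjective {x₀ x : M} (hx : x ∈ (extChartAt 𝓘(ℝ, E) x₀).source) :
    Function.Surjective (chartDeriv x₀ x : TangentSpace 𝓘(ℝ, E) x → E) := by
  have : IsManifold 𝓘(ℝ, E) 1 M := .of_le (n := ∞) (by simp)
  exact (isInvertible_mfderiv_extChartAt (I := 𝓘(ℝ, E)) hx).bijective.surjective

lemma chartVField_extChartAt (ξ : VField E M) {x₀ x : M}
    (hx : x ∈ (extChartAt 𝓘(ℝ, E) x₀).source) :
    chartVField ξ x₀ (extChartAt 𝓘(ℝ, E) x₀ x) = chartDeriv x₀ x (ξ x) := by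
  have : IsManifold 𝓘(ℝ, E) 1 M := .of_le (n := ∞) (by simp)
  have hinv := isInvertible_mfderivWithin_extChartAt_symm (I := 𝓘(ℝ, E))
    ((extChartAt 𝓘(ℝ, E) x₀).map_source hx)
  rw [modelWithCornersSelf_coe, Set.range_id, mfderivWithin_univ] at hinv
  apply hinv.bijective.injective
  rw [chartVField, VectorField.mpullback_apply]
  refine (hinv.self_apply_inverse _).trans ?_
  refine Eq.trans ?_ (mfderiv_extChartAt_symm_chartDeriv hx _).symm
  rw [(extChartAt 𝓘(ℝ, E) x₀).left_inv hx]

lemma chartTensor_extChartAt (φ : TensorField E M k F) {x₀ x : M}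
    (hx : x ∈ (extChartAt 𝓘(ℝ, E) x₀).source) (v : Fin k → TangentSpace 𝓘(ℝ, E) x) :
    chartTensor φ x₀ (extChartAt 𝓘(ℝ, E) x₀ x) (fun i => chartDeriv x₀ x (v i)) = φ x v := by
  -- The chart followed by its inverse returns `x` only propositionally, and the tangent space
  -- depends on the base point; generalizing the point permits substitution.
  have h : ∀ x', x' = x → ∀ w : Fin k → E, (∀ i, w i = v i) → φ x' w = φ x v := by
    rintro x' rfl w hw
    exact congrArg (φ x') (funext hw)
  exact h _ ((extChartAt 𝓘(ℝ, E) x₀).left_inv hx) _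
    fun i => mfderiv_extChartAt_symm_chartDeriv hx (v i)

/-- Two tensor fields that agree near `x` agree near `x` in the chart. -/
lemma chartTensor_congr {φ φ' : TensorField E M k F} {x : M} (h : ∀ᶠ z in 𝓝 x, φ z = φ' z) :
    chartTensor φ x =ᶠ[𝓝 (extChartAt 𝓘(ℝ, E) x x)] chartTensor φ' x := by
  apply eventually_nhds_extChartAt
  filter_upwards [h, extChartAt_source_mem_nhds (I := 𝓘(ℝ, E)) x] with z hz hzs
  ext w
  choose v hv using fun i => chartDeriv_surjective hzs (w i)
  obtain rfl : (fun i => chartDeriv x z (v i)) = w := funext hv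
  rw [chartTensor_extChartAt φ hzs, chartTensor_extChartAt φ' hzs, hz]

lemma lieDeriv_congr {ξ : VField E M} {φ φ' : TensorField E M k F} {x : M}
    (h : ∀ᶠ z in 𝓝 x, φ z = φ' z) : lieDeriv ξ φ x = lieDeriv ξ φ' x := by
  ext v
  rw [lieDeriv_apply, lieDeriv_apply, lieDerivFlat_congr (chartTensor_congr h)]

lemma differentiableVFieldAt_of_contMDiffAt [CompleteSpace E] {ξ : VField E M} {x : M}
    (hξ : ContMDiffAt 𝓘(ℝ, E) 𝓘(ℝ, E).tangent 1
      (fun z => (⟨z, ξ z⟩ : TangentBundle 𝓘(ℝ, E) M)) x) : DifferentiableVFieldAt ξ x := by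
  have : IsManifold 𝓘(ℝ, E) (1 + 1) M := .of_le (n := ∞) (by norm_cast)
  have h := VectorField.contMDiffWithinAt_mpullbackWithin_extChartAt_symm (I := 𝓘(ℝ, E)) (n := 2)
    (m := 1) (s := Set.univ) (V := ξ) (x := x) hξ uniqueMDiffOn_univ (Set.mem_univ x) (by norm_num)
  rw [contMDiffWithinAt_vectorSpace_iff_contDiffWithinAt] at h
  simp only [modelWithCornersSelf_coe, Set.range_id, VectorField.mpullbackWithin_univ,
    Set.preimage_univ, Set.inter_univ] at h
  exact (h.contDiffAt (extChartAt_target_mem_nhds x)).differentiableAt (by simp)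

variable [IsManifold 𝓘(ℝ, E') ∞ M'] {f : M → M'} {x : M}

lemma eventually_mdifferentiableAt (hf : ContMDiffAt 𝓘(ℝ, E) 𝓘(ℝ, E') ∞ f x) :
    ∀ᶠ z in 𝓝 x, MDifferentiableAt 𝓘(ℝ, E) 𝓘(ℝ, E') f z := by
  have : IsManifold 𝓘(ℝ, E) 1 M := .of_le (n := ∞) (by simp)
  have : IsManifold 𝓘(ℝ, E') 1 M' := .of_le (n := ∞) (by simp)
  have h : ContMDiffAt 𝓘(ℝ, E) 𝓘(ℝ, E') 1 f x := hf.of_le (by simp)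
  exact ((contMDiffAt_iff_contMDiffAt_nhds (by simp)).1 h).mono fun z hz => hz.mdifferentiableAt (by simp)

/-- The chain rule for the two sides of `F ∘ chart = chart' ∘ f`. It is needed on a neighbourhood,
not just at `x`, since the pullback formula built from it is differentiated once more. -/
lemma fderiv_writtenInExtChartAt (hf : ContMDiffAt 𝓘(ℝ, E) 𝓘(ℝ, E') ∞ f x) :
    ∀ᶠ z in 𝓝 x, ∀ v : TangentSpace 𝓘(ℝ, E) z,
      fderiv ℝ (writtenInExtChartAt 𝓘(ℝ, E) 𝓘(ℝ, E') x f) (extChartAt 𝓘(ℝ, E) x z)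
        (chartDeriv x z v) = chartDeriv (f x) (f z) (mfderiv 𝓘(ℝ, E) 𝓘(ℝ, E') f z v) := by
  have : IsManifold 𝓘(ℝ, E) 1 M := .of_le (n := ∞) (by simp)
  have : IsManifold 𝓘(ℝ, E') 1 M' := .of_le (n := ∞) (by simp)
  have hsrc := extChartAt_source_mem_nhds (I := 𝓘(ℝ, E)) x
  filter_upwards [eventually_mdifferentiableAt hf, hsrc,
    hf.continuousAt (extChartAt_source_mem_nhds (I := 𝓘(ℝ, E')) (f x))] with z hfz hz hfzs v
  have hu : MDifferentiableAt 𝓘(ℝ, E) 𝓘(ℝ, E) (extChartAt 𝓘(ℝ, E) x) z :=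
    mdifferentiableAt_extChartAt (by rwa [← extChartAt_source (I := 𝓘(ℝ, E))])
  have hu' : MDifferentiableAt 𝓘(ℝ, E') 𝓘(ℝ, E') (extChartAt 𝓘(ℝ, E') (f x)) (f z) :=
    mdifferentiableAt_extChartAt (by rwa [← extChartAt_source (I := 𝓘(ℝ, E'))])
  have hinv := (extChartAt 𝓘(ℝ, E) x).left_inv hz
  have hs : MDifferentiableAt 𝓘(ℝ, E) 𝓘(ℝ, E) (extChartAt 𝓘(ℝ, E) x).symm
      (extChartAt 𝓘(ℝ, E) x z) := by
    have h := mdifferentiableWithinAt_extChartAt_symm (I := 𝓘(ℝ, E))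
      ((extChartAt 𝓘(ℝ, E) x).map_source hz)
    rwa [modelWithCornersSelf_coe, Set.range_id, mdifferentiableWithinAt_univ] at h
  have hF : MDifferentiableAt 𝓘(ℝ, E) 𝓘(ℝ, E') (writtenInExtChartAt 𝓘(ℝ, E) 𝓘(ℝ, E') x f)
      (extChartAt 𝓘(ℝ, E) x z) := by
    have h : MDifferentiableAt 𝓘(ℝ, E) 𝓘(ℝ, E') (f ∘ (extChartAt 𝓘(ℝ, E) x).symm)
        (extChartAt 𝓘(ℝ, E) x z) := MDifferentiableAt.comp _ (by rwa [hinv]) hs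
    exact MDifferentiableAt.comp _ (by rwa [Function.comp_apply, hinv]) h
  have heq : writtenInExtChartAt 𝓘(ℝ, E) 𝓘(ℝ, E') x f ∘ extChartAt 𝓘(ℝ, E) x =ᶠ[𝓝 z]
      extChartAt 𝓘(ℝ, E') (f x) ∘ f := by
    filter_upwards [(isOpen_extChartAt_source (I := 𝓘(ℝ, E)) x).mem_nhds hz] with w hw
    simp only [writtenInExtChartAt, Function.comp_apply, (extChartAt 𝓘(ℝ, E) x).left_inv hw]
  have h := heq.mfderiv_eq (I := 𝓘(ℝ, E)) (I' := 𝓘(ℝ, E'))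
  rw [mfderiv_comp z hF hu, mfderiv_comp z hu' hfz, mfderiv_eq_fderiv] at h
  exact DFunLike.congr_fun h v

lemma chartTensor_pullback (φ : TensorField E' M' k F)
    (hf : ContMDiffAt 𝓘(ℝ, E) 𝓘(ℝ, E') ∞ f x) :
    chartTensor (pullback f φ) x =ᶠ[𝓝 (extChartAt 𝓘(ℝ, E) x x)] fun y =>
      (chartTensor φ (f x) (writtenInExtChartAt 𝓘(ℝ, E) 𝓘(ℝ, E') x f y)).compContinuousLinearMap
        fun _ => fderiv ℝ (writtenInExtChartAt 𝓘(ℝ, E) 𝓘(ℝ, E') x f) y := by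
  apply eventually_nhds_extChartAt
  filter_upwards [fderiv_writtenInExtChartAt hf, extChartAt_source_mem_nhds (I := 𝓘(ℝ, E)) x,
    hf.continuousAt (extChartAt_source_mem_nhds (I := 𝓘(ℝ, E')) (f x))] with z hz hzs hfz
  ext w
  choose v hv using fun i => chartDeriv_surjective hzs (w i)
  obtain rfl : (fun i => chartDeriv x z (v i)) = w := funext hv
  rw [chartTensor_extChartAt _ hzs]
  simp only [ContinuousMultilinearMap.compContinuousLinearMap_apply, hz]
  have : writtenInExtChartAt 𝓘(ℝ, E) 𝓘(ℝ, E') x f (extChartAt 𝓘(ℝ, E) x z) =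
      extChartAt 𝓘(ℝ, E') (f x) (f z) := by
    simp only [writtenInExtChartAt, Function.comp_apply, (extChartAt 𝓘(ℝ, E) x).left_inv hzs]
  rw [this, chartTensor_extChartAt φ hfz]
  rfl

lemma differentiableTensorAt_pullback {φ : TensorField E' M' k F}
    (hφ : DifferentiableTensorAt φ (f x)) (hf : ContMDiffAt 𝓘(ℝ, E) 𝓘(ℝ, E') ∞ f x) :
    DifferentiableTensorAt (E := E) (pullback f φ) x := by
  refine DifferentiableAt.congr_of_eventuallyEq ?_ (chartTensor_pullback φ hf)
  have hF := contDiffAt_writtenInExtChartAt hf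
  have h1 : DifferentiableAt ℝ (chartTensor φ (f x))
      (writtenInExtChartAt 𝓘(ℝ, E) 𝓘(ℝ, E') x f (extChartAt 𝓘(ℝ, E) x x)) := by
    simp only [writtenInExtChartAt, Function.comp_apply, extChartAt_to_inv]
    exact hφ
  refine DifferentiableAt.continuousMultilinearMapCompContinuousLinearMap
    (h1.comp _ (hF.differentiableAt (by simp))) fun _ => ?_
  exact (hF.fderiv_right (m := 1) (by norm_cast)).differentiableAt (by simp)

/-- Naturality of the Lie derivative: if `f` relates `ξ` and `Z` near `x`, then
`L_ξ (f^* φ) = f^* (L_Z φ)` at `x`. -/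
theorem lieDeriv_pullback {φ : TensorField E' M' k F} {ξ : VField E M} {Z : VField E' M'}
    (hf : ContMDiffAt 𝓘(ℝ, E) 𝓘(ℝ, E') ∞ f x) (hφ : DifferentiableTensorAt φ (f x))
    (hξ : DifferentiableVFieldAt ξ x) (hZ : DifferentiableVFieldAt Z (f x))
    (hrel : ∀ᶠ z in 𝓝 x, mfderiv 𝓘(ℝ, E) 𝓘(ℝ, E') f z (ξ z) = Z (f z)) :
    lieDeriv ξ (pullback f φ) x = pullback f (lieDeriv Z φ) x := by
  have hx : writtenInExtChartAt 𝓘(ℝ, E) 𝓘(ℝ, E') x f (extChartAt 𝓘(ℝ, E) x x) =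
      extChartAt 𝓘(ℝ, E') (f x) (f x) := by
    simp only [writtenInExtChartAt, Function.comp_apply, extChartAt_to_inv]
  have hF := fderiv_writtenInExtChartAt hf
  ext v
  rw [lieDeriv_apply, lieDerivFlat_congr (chartTensor_pullback φ hf),
    lieDerivFlat_pullback ((contDiffAt_writtenInExtChartAt hf).of_le (by norm_cast))
      (by rwa [hx]) hξ (Z := chartVField Z (f x)) (by rwa [hx])]
  · simp only [ContinuousMultilinearMap.compContinuousLinearMap_apply, hF.self_of_nhds, hx]
    rfl
  · apply eventually_nhds_extChartAt
    filter_upwards [hF, hrel, extChartAt_source_mem_nhds (I := 𝓘(ℝ, E)) x,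
      hf.continuousAt (extChartAt_source_mem_nhds (I := 𝓘(ℝ, E')) (f x))] with z hz hr hzs hfz
    rw [chartVField_extChartAt ξ hzs, hz, hr, ← chartVField_extChartAt Z hfz]
    simp only [writtenInExtChartAt, Function.comp_apply, (extChartAt 𝓘(ℝ, E) x).left_inv hzs]

/-- If `f` relates `ξ` and `Z` near `x` and `L_Z φ = 0`, then `L_ξ (f^* φ) = 0` at `x`. -/
lemma lieDeriv_pullback_eq_zero {φ : TensorField E' M' k F} {ξ : VField E M} {Z : VField E' M'}
    (hf : ContMDiffAt 𝓘(ℝ, E) 𝓘(ℝ, E') ∞ f x) (hφ : DifferentiableTensorAt φ (f x))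
    (hξ : DifferentiableVFieldAt ξ x) (hZ : DifferentiableVFieldAt Z (f x))
    (hrel : ∀ᶠ z in 𝓝 x, mfderiv 𝓘(ℝ, E) 𝓘(ℝ, E') f z (ξ z) = Z (f z))
    (h0 : lieDeriv Z φ (f x) = 0) : lieDeriv ξ (pullback f φ) x = 0 := by
  rw [lieDeriv_pullback hf hφ hξ hZ hrel]
  ext v
  simp [pullback, h0]

/-- The derivative of the vector-valued function `H` in the direction `v`. -/
noncomputable def dirDeriv {W : Type*} [NormedAddCommGroup W] [NormedSpace ℝ W] (H : M → W) (x : M)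
    (v : TangentSpace 𝓘(ℝ, E) x) : W :=
  mfderiv 𝓘(ℝ, E) 𝓘(ℝ, W) H x v

/-- The product rule for the Lie derivative. -/
theorem lieDeriv_comp {H : M → F →L[ℝ] F'} {φ : TensorField E M k F} {ξ : VField E M}
    (hH : ContMDiffAt 𝓘(ℝ, E) 𝓘(ℝ, F →L[ℝ] F') ∞ H x) (hφ : DifferentiableTensorAt φ x)
    (v : Fin k → TangentSpace 𝓘(ℝ, E) x) :
    lieDeriv ξ (fun z => (H z).compContinuousMultilinearMap (φ z)) x v =
      dirDeriv H x (ξ x) (φ x v) + H x (lieDeriv ξ φ x v) := by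
  have hs := mem_extChartAt_source (I := 𝓘(ℝ, E)) x
  have hF : fderiv ℝ (H ∘ (extChartAt 𝓘(ℝ, E) x).symm) (extChartAt 𝓘(ℝ, E) x x)
      (chartDeriv x x (ξ x)) = dirDeriv H x (ξ x) := by
    refine ((fderiv_writtenInExtChartAt hH).self_of_nhds (ξ x)).trans ?_
    have hid : chartDeriv (E := F →L[ℝ] F') (H x) (H x) = ContinuousLinearMap.id ℝ _ := mfderiv_id
    rw [hid]
    rfl
  have h := lieDerivFlat_comp (H := H ∘ (extChartAt 𝓘(ℝ, E) x).symm) (φ := chartTensor φ x)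
    (ξ := chartVField ξ x) ((contDiffAt_writtenInExtChartAt hH).differentiableAt (by simp)) hφ
    (fun i => chartDeriv x x (v i))
  rw [chartVField_extChartAt ξ hs, hF, chartTensor_extChartAt φ hs, Function.comp_apply,
    extChartAt_to_inv] at h
  exact h

end ManifoldCalculus
end KosmannSymmetry

/-! ### Coframes, Kosmann lifts, and sections that relate them. -/

namespace KosmannSymmetry

section Bundles

lemma eta_single (d : ℕ) (a : Mink d) (i : Fin (d + 1)) :
    eta d a (Pi.single i 1) = a i * if i = 0 then -1 else 1 := by
  simp [eta, Matrix.toBilin'_apply']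

lemma eq_zero_of_eta_eq_zero {d : ℕ} {a : Mink d} (h : ∀ b, eta d a b = 0) : a = 0 := by
  ext i
  have hi := h (Pi.single i 1)
  rw [eta_single] at hi
  rcases mul_eq_zero.1 hi with hi | hi
  · exact hi
  · split_ifs at hi <;> norm_num at hi

lemma toEnd_mul {d : ℕ} (A B : SO d) (v : Mink d) : toEnd (A * B) v = toEnd A (toEnd B v) := rfl

lemma toEnd_injective {d : ℕ} (A : SO d) : Function.Injective (toEnd A) :=
  (A : Mink d ≃L[ℝ] Mink d).injective

lemma vec_one_eta {α : Type*} (v : Fin 1 → α) : v = ![v 0] := by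
  ext i; rw [Subsingleton.elim i 0]; rfl

lemma map_vec_sub {E F : Type*} [AddCommGroup E] [Module ℝ E] [TopologicalSpace E]
    [NormedAddCommGroup F] [NormedSpace ℝ F] (T : ContinuousMultilinearMap ℝ (fun _ : Fin 1 => E) F) (v w : E) :
    T ![v - w] = T ![v] - T ![w] := by
  have h : ∀ u : E, Function.update ![0] 0 u = ![u] := fun u => by
    rw [vec_one_eta (Function.update _ _ _), Function.update_self]
  simpa only [h] using T.map_update_sub ![0] 0 v w

variable {d : ℕ}
  {EX X : Type*} [NormedAddCommGroup EX] [NormedSpace ℝ EX]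
  [TopologicalSpace X] [ChartedSpace EX X]
  {EQ Q : Type*} [NormedAddCommGroup EQ] [NormedSpace ℝ EQ]
  [TopologicalSpace Q] [ChartedSpace EQ Q] [MulAction (SO d)ᵐᵒᵖ Q]
  {π : Q → X} {e : TensorField EQ Q 1 (Mink d)} {g : TensorField EX X 2 ℝ}
  {ξ : VField EX X} {Z : VField EQ Q}

/-- The values of a coframe at two points of the same orbit. -/
lemma IsCoframe.apply_rmul (hπ : IsPrincipalSOBundle d EX EQ π) (he : IsCoframe (EX := EX) π e)
    {p q : Q} {s : SO d} (hq : q = rmul s p) (v : TangentSpace 𝓘(ℝ, EQ) q)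
    (w : TangentSpace 𝓘(ℝ, EQ) p)
    (hvw : (mfderiv 𝓘(ℝ, EQ) 𝓘(ℝ, EX) π q v : EX) = mfderiv 𝓘(ℝ, EQ) 𝓘(ℝ, EX) π p w) :
    e q ![v] = toEnd s⁻¹ (e p ![w]) := by
  subst hq
  rw [← he.equivariant s p w]
  have hd : (mfderiv 𝓘(ℝ, EQ) 𝓘(ℝ, EX) π (rmul s p)
      (mfderiv 𝓘(ℝ, EQ) 𝓘(ℝ, EQ) (rmul s) p w) : EX) = mfderiv 𝓘(ℝ, EQ) 𝓘(ℝ, EX) π p w := by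
    have h := mfderiv_comp p (hπ.smooth_proj.mdifferentiableAt (by simp))
      ((hπ.smooth_rmul s).mdifferentiableAt (x := p) (by simp))
    have hπs : π ∘ rmul s = π := funext (hπ.proj_rmul s)
    rw [hπs] at h
    exact (DFunLike.congr_fun h w).symm
  -- The two vectors have the same projection, so they differ by a vertical vector, which `e` kills.
  have h0 : e (rmul s p) ![v - mfderiv 𝓘(ℝ, EQ) 𝓘(ℝ, EQ) (rmul s) p w] = 0 := by
    rw [he.ker_eq, map_sub, sub_eq_zero]
    exact hvw.trans hd.symm
  have hsub := map_vec_sub (e (rmul s p)) v (mfderiv 𝓘(ℝ, EQ) 𝓘(ℝ, EQ) (rmul s) p w)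
  rw [h0] at hsub
  exact sub_eq_zero.1 hsub.symm

/-- The differential of a section is a section of the differential. -/
lemma mfderiv_proj_section {U : Set X} {f : X → Q} (hπ : ContMDiff 𝓘(ℝ, EQ) 𝓘(ℝ, EX) ∞ π)
    (hU : IsOpen U) (hf : ContMDiffOn 𝓘(ℝ, EX) 𝓘(ℝ, EQ) ∞ f U) (hfπ : ∀ x ∈ U, π (f x) = x) {x : X}
    (hx : x ∈ U) (v : TangentSpace 𝓘(ℝ, EX) x) :
    (mfderiv 𝓘(ℝ, EQ) 𝓘(ℝ, EX) π (f x) (mfderiv 𝓘(ℝ, EX) 𝓘(ℝ, EQ) f x v) : EX) = v := by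
  have h := mfderiv_comp x (hπ.mdifferentiableAt (by simp))
    ((hf.contMDiffAt (hU.mem_nhds hx)).mdifferentiableAt (by simp))
  have hid : π ∘ f =ᶠ[𝓝 x] id := Filter.mem_of_superset (hU.mem_nhds hx) hfπ
  rw [hid.mfderiv_eq, mfderiv_id] at h
  exact (DFunLike.congr_fun h v).symm

variable [IsManifold 𝓘(ℝ, EQ) ∞ Q]

/-- If the Kosmann Lie derivative of the coframe along `ξ` vanishes, then the Lie derivative of the
coframe along any Kosmann lift of `ξ` vanishes. -/
lemma IsKosmannLift.lieDeriv_coframe_eq_zero (he : IsCoframe (EX := EX) π e)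
    (h0 : HasKosmannLieDerivCoframe π e g ξ 0) (hZ : IsKosmannLift π e g ξ Z) (q : Q) :
    lieDeriv Z e q = 0 := by
  obtain ⟨Z₁, hZ₁, h1⟩ := h0
  ext1 v
  rw [vec_one_eta v]
  refine eq_zero_of_eta_eq_zero fun b => ?_
  obtain ⟨w, rfl⟩ := he.surjective q b
  -- Both lifts compute the same `L_ξ g`; the lift `Z₁` shows that it is zero.
  have h2 := hZ.kosmann q (v 0) w
  rw [hZ₁.kosmann q (v 0) w, h1 q] at h2
  simpa using h2.symm

/-- A vector field which is the projection of a smooth vector field is differentiable wherever there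
is a smooth local section. -/
lemma differentiableVFieldAt_of_proj [FiniteDimensional ℝ EX] [IsManifold 𝓘(ℝ, EX) ∞ X] {U : Set X}
    {f : X → Q} (hπ : ContMDiff 𝓘(ℝ, EQ) 𝓘(ℝ, EX) ∞ π)
    (hU : IsOpen U) (hf : ContMDiffOn 𝓘(ℝ, EX) 𝓘(ℝ, EQ) ∞ f U) (hfπ : ∀ x ∈ U, π (f x) = x)
    (hZ : IsSmoothVField Z) (hproj : ∀ q, mfderiv 𝓘(ℝ, EQ) 𝓘(ℝ, EX) π q (Z q) = ξ (π q))
    {x : X} (hx : x ∈ U) : DifferentiableVFieldAt ξ x := by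
  have := FiniteDimensional.complete ℝ EX
  have : IsManifold 𝓘(ℝ, EX) 1 X := .of_le (n := ∞) (by simp)
  have : IsManifold 𝓘(ℝ, EQ) 1 Q := .of_le (n := ∞) (by simp)
  apply differentiableVFieldAt_of_contMDiffAt
  have h1 : ContMDiff 𝓘(ℝ, EQ).tangent 𝓘(ℝ, EX).tangent 1 (tangentMap 𝓘(ℝ, EQ) 𝓘(ℝ, EX) π) :=
    hπ.contMDiff_tangentMap (by norm_cast)
  -- On `U` the field `ξ` is the composite of `f`, `Z` and the tangent map of `π`, which gives its
  -- regularity.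
  have h2 : ContMDiffAt 𝓘(ℝ, EX) 𝓘(ℝ, EX).tangent 1 (fun z => tangentMap 𝓘(ℝ, EQ) 𝓘(ℝ, EX) π
      (⟨f z, Z (f z)⟩ : TangentBundle 𝓘(ℝ, EQ) Q)) x :=
    (h1.contMDiffAt.comp (f x) ((ContMDiff.contMDiffAt hZ).of_le (by simp))).comp x
      ((hf.contMDiffAt (hU.mem_nhds hx)).of_le (by simp))
  refine h2.congr_of_eventuallyEq ?_
  filter_upwards [hU.mem_nhds hx] with z hz
  have h3 : tangentMap 𝓘(ℝ, EQ) 𝓘(ℝ, EX) π (⟨f z, Z (f z)⟩ : TangentBundle 𝓘(ℝ, EQ) Q) =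
      ⟨π (f z), ξ (π (f z))⟩ := by rw [← hproj]; rfl
  rw [h3, hfπ z hz]

/-- If the Lie derivatives of the coframe along `Z` and of its pullback by a section `f` along `ξ`
vanish, where `Z` projects to `ξ`, then `f` relates `ξ` and `Z`. -/
theorem mfderiv_section_eq [FiniteDimensional ℝ EX] [IsManifold 𝓘(ℝ, EX) ∞ X] {U : Set X}
    {f : X → Q} (hπ : IsPrincipalSOBundle d EX EQ π) (he : IsCoframe (EX := EX) π e)
    (hU : IsOpen U) (hf : ContMDiffOn 𝓘(ℝ, EX) 𝓘(ℝ, EQ) ∞ f U) (hfπ : ∀ x ∈ U, π (f x) = x)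
    (hZ : IsSmoothVField Z) (hZd : ∀ q, DifferentiableVFieldAt Z q)
    (hproj : ∀ q, mfderiv 𝓘(ℝ, EQ) 𝓘(ℝ, EX) π q (Z q) = ξ (π q))
    (hLZ : ∀ q, lieDeriv Z e q = 0) (hLξ : ∀ x ∈ U, lieDeriv ξ (pullback f e) x = 0)
    {x : X} (hx : x ∈ U) : mfderiv 𝓘(ℝ, EX) 𝓘(ℝ, EQ) f x (ξ x) = Z (f x) := by
  obtain ⟨U', hU', hxU', h, hmul, hsm, himm, hemb, -⟩ := hπ.locally_trivial x
  set H : Q → Mink d →L[ℝ] Mink d := fun q => toEnd (h q) with hHdef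
  have hπx := hfπ x hx
  have hπ' := hπ.smooth_proj
  have hfx : ContMDiffAt 𝓘(ℝ, EX) 𝓘(ℝ, EQ) ∞ f x := hf.contMDiffAt (hU.mem_nhds hx)
  have hfx' : ContMDiffAt 𝓘(ℝ, EX) 𝓘(ℝ, EQ) ∞ f (π (f x)) := by rwa [hπx]
  have hH : ContMDiffAt 𝓘(ℝ, EQ) 𝓘(ℝ, Mink d →L[ℝ] Mink d) ∞ H (f x) :=
    hsm.contMDiffAt ((hU'.preimage hπ'.continuous).mem_nhds (by simpa [hπx] using hxU'))
  have hH' : ContMDiffAt 𝓘(ℝ, EQ) 𝓘(ℝ, Mink d →L[ℝ] Mink d) ∞ H (f (π (f x))) := by rwa [hπx]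
  have hfp : ContMDiffAt 𝓘(ℝ, EQ) 𝓘(ℝ, EQ) ∞ (f ∘ π) (f x) := hfx'.comp (f x) hπ'.contMDiffAt
  have hK : ContMDiffAt 𝓘(ℝ, EQ) 𝓘(ℝ, Mink d →L[ℝ] Mink d) ∞ (H ∘ (f ∘ π)) (f x) :=
    ContMDiffAt.comp (f x) hH' hfp
  -- The product `H · e` takes equal values on vectors with the same projection at points of one
  -- fibre, because the equivariance of `e` cancels that of `H`. Compare the points `q` and `f (π
  -- q)`.
  have heq : ∀ q, π q ∈ U → π q ∈ U' → (H q).compContinuousMultilinearMap (e q) =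
      (H (f (π q))).compContinuousMultilinearMap (pullback π (pullback (E := EX) f e) q) := by
    intro q hqU hqU'
    ext1 v
    rw [vec_one_eta v]
    have hp := hfπ _ hqU
    have hpU' : π (f (π q)) ∈ U' := by rwa [hp]
    -- The group element is forced by `h`; the two sides have the same image under the injective map
    -- `(π, H)`.
    have hq : q = rmul ((h (f (π q)))⁻¹ * h q) (f (π q)) := by
      have hmem : π (rmul ((h (f (π q)))⁻¹ * h q) (f (π q))) ∈ U' := by rwa [hπ.proj_rmul]
      have := @hemb.injective ⟨q, hqU'⟩ ⟨_, hmem⟩ (by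
        simp only [Prod.mk.injEq]
        rw [hπ.proj_rmul, hp, hmul _ hpU', mul_inv_cancel_left]
        exact ⟨rfl, rfl⟩)
      exact congrArg Subtype.val this
    have h1 := he.apply_rmul hπ hq (v 0)
      (mfderiv 𝓘(ℝ, EX) 𝓘(ℝ, EQ) f (π q) (mfderiv 𝓘(ℝ, EQ) 𝓘(ℝ, EX) π q (v 0)))
      (mfderiv_proj_section hπ' hU hf hfπ hqU _).symm
    have h2 : pullback π (pullback (E := EX) f e) q ![v 0] = e (f (π q))
        ![mfderiv 𝓘(ℝ, EX) 𝓘(ℝ, EQ) f (π q) (mfderiv 𝓘(ℝ, EQ) 𝓘(ℝ, EX) π q (v 0))] := by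
      refine congrArg (e (f (π q))) ?_
      rw [vec_one_eta (fun _ => _)]
      rfl
    simp only [ContinuousLinearMap.compContinuousMultilinearMap_coe, Function.comp_apply]
    rw [h2, h1]
    simp only [hHdef, ← toEnd_mul]
    congr 2
    group
  have hα : DifferentiableTensorAt (pullback (E := EX) f e) (π (f x)) :=
    differentiableTensorAt_pullback (he.smooth.differentiableTensorAt _) hfx'
  have hξ : DifferentiableVFieldAt ξ (π (f x)) := by
    rw [hπx]; exact differentiableVFieldAt_of_proj hπ' hU hf hfπ hZ hproj hx
  -- Here adaptedness of the gauge enters, through naturality along `π`, which relates `Z` to `ξ`.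
  have hLα : lieDeriv Z (pullback π (pullback (E := EX) f e)) (f x) = 0 :=
    lieDeriv_pullback_eq_zero hπ'.contMDiffAt hα (hZd _) hξ (Filter.Eventually.of_forall hproj)
      (hLξ _ (by rwa [hπx]))
  have hmem : ∀ᶠ q in 𝓝 (f x), π q ∈ U ∩ U' :=
    hπ'.continuous.continuousAt ((hU.inter hU').mem_nhds ⟨by rwa [hπx], by rwa [hπx]⟩)
  have hL := lieDeriv_congr (ξ := Z) (hmem.mono fun q hq => heq q hq.1 hq.2)
  -- Apply the product rule to both sides of `heq`. At `f x` the matrix factors coincide and are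
  -- injective, so the two forms agree there (`h4`) and the surviving derivatives act on the same
  -- vector `e v`, which is arbitrary.
  have hdir : dirDeriv H (f x) (Z (f x)) = dirDeriv (H ∘ (f ∘ π)) (f x) (Z (f x)) := by
    ext1 a
    obtain ⟨v, rfl⟩ := he.surjective (f x) a
    have h1 := lieDeriv_comp (ξ := Z) hH (he.smooth.differentiableTensorAt _) ![v]
    have h2 := lieDeriv_comp (ξ := Z) hK (differentiableTensorAt_pullback hα hπ'.contMDiffAt) ![v]
    have h3 := DFunLike.congr_fun (heq (f x) (by rwa [hπx]) (by rwa [hπx])) ![v]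
    simp only [ContinuousLinearMap.compContinuousMultilinearMap_coe, Function.comp_apply] at h3
    rw [hπx] at h3
    have h4 := toEnd_injective _ h3
    rw [hLZ] at h1
    rw [hLα, ← h4] at h2
    have h5 := h1.symm.trans ((DFunLike.congr_fun hL ![v]).trans h2)
    simpa using h5
  have hdir' : dirDeriv (H ∘ (f ∘ π)) (f x) (Z (f x)) =
      dirDeriv H (f x) (mfderiv 𝓘(ℝ, EX) 𝓘(ℝ, EQ) f x (ξ x)) := by
    -- The chain rule lands at the base point `π (f x)`; this moves the statement to `x` across the
    -- dependent tangent spaces.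
    have h1 : ∀ y, y = x → dirDeriv H (f y) (mfderiv 𝓘(ℝ, EX) 𝓘(ℝ, EQ) f y (ξ y)) =
        dirDeriv H (f x) (mfderiv 𝓘(ℝ, EX) 𝓘(ℝ, EQ) f x (ξ x)) := by rintro y rfl; rfl
    rw [← h1 _ hπx, ← hproj]
    have h2 := mfderiv_comp (f x) (hH'.mdifferentiableAt (by simp))
      (hfp.mdifferentiableAt (by simp))
    rw [mfderiv_comp (f x) (hfx'.mdifferentiableAt (by simp))
      (hπ'.mdifferentiableAt (by simp))] at h2
    exact DFunLike.congr_fun h2 (Z (f x))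
  rw [← sub_eq_zero]
  -- The immersion property of `(π, H)`: the difference of the two vectors is killed by `dπ` and by
  -- `dH`.
  refine himm (f x) (by rwa [hπx]) _ ?_ ?_
  · rw [map_sub, sub_eq_zero]
    have h1 : (ξ (π (f x)) : EX) = ξ x := by rw [hπx]
    exact (mfderiv_proj_section hπ' hU hf hfπ hx _).trans (h1.symm.trans (hproj (f x)).symm)
  · rw [map_sub, sub_eq_zero]
    exact (hdir.trans hdir').symm

end Bundles
end KosmannSymmetry

/-! ### Passage from `Q` to the spin bundle along `Λ`. -/

namespace KosmannSymmetry

section SpinLift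

variable {EX X : Type*} [NormedAddCommGroup EX] [NormedSpace ℝ EX]
  [TopologicalSpace X] [ChartedSpace EX X]
  {EQ Q : Type*} [NormedAddCommGroup EQ] [NormedSpace ℝ EQ]
  [TopologicalSpace Q] [ChartedSpace EQ Q]
  {EP P : Type*} [NormedAddCommGroup EP] [NormedSpace ℝ EP]
  [TopologicalSpace P] [ChartedSpace EP P]
  {Λ : P → Q} {Z : VField EQ Q} {ξ : VField EX X}

lemma isInvertible_mfderiv_of_isLocalDiffeomorph (hΛ : IsLocalDiffeomorph 𝓘(ℝ, EP) 𝓘(ℝ, EQ) ∞ Λ)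
    (p : P) : (mfderiv 𝓘(ℝ, EP) 𝓘(ℝ, EQ) Λ p).IsInvertible :=
  ⟨hΛ.mfderivToContinuousLinearEquiv (by simp) p, rfl⟩

/-- The lift is the inverse of `dΛ` applied to `Z`, and `dΛ` is injective, so the relation may be
tested after applying `dΛ`. -/
lemma mfderiv_eq_spinLift {σ : X → P} {x : X} (hΛ : IsLocalDiffeomorph 𝓘(ℝ, EP) 𝓘(ℝ, EQ) ∞ Λ)
    (hσ : MDifferentiableAt 𝓘(ℝ, EX) 𝓘(ℝ, EP) σ x)
    (h : mfderiv 𝓘(ℝ, EX) 𝓘(ℝ, EQ) (Λ ∘ σ) x (ξ x) = Z (Λ (σ x))) :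
    mfderiv 𝓘(ℝ, EX) 𝓘(ℝ, EP) σ x (ξ x) = spinLift Λ Z (σ x) := by
  have hinv := isInvertible_mfderiv_of_isLocalDiffeomorph hΛ (σ x)
  apply hinv.bijective.injective
  rw [mfderiv_comp x (hΛ.contMDiff.mdifferentiableAt (by simp)) hσ] at h
  exact h.trans (hinv.self_apply_inverse _).symm

variable [IsManifold 𝓘(ℝ, EQ) ∞ Q] [FiniteDimensional ℝ EQ]

lemma IsSmoothVField.differentiableVFieldAt (hZ : IsSmoothVField Z) (q : Q) :
    DifferentiableVFieldAt Z q := by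
  have := FiniteDimensional.complete ℝ EQ
  exact differentiableVFieldAt_of_contMDiffAt ((ContMDiff.contMDiffAt hZ).of_le (by simp))

variable [IsManifold 𝓘(ℝ, EP) ∞ P] [FiniteDimensional ℝ EP]

lemma differentiableVFieldAt_spinLift (hΛ : IsLocalDiffeomorph 𝓘(ℝ, EP) 𝓘(ℝ, EQ) ∞ Λ)
    (hZ : IsSmoothVField Z) (p : P) : DifferentiableVFieldAt (spinLift (EP := EP) Λ Z) p := by
  have := FiniteDimensional.complete ℝ EP
  have := FiniteDimensional.complete ℝ EQ
  have : IsManifold 𝓘(ℝ, EP) (1 + 1) P := .of_le (n := ∞) (by norm_cast)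
  have : IsManifold 𝓘(ℝ, EQ) (1 + 1) Q := .of_le (n := ∞) (by norm_cast)
  have : IsManifold 𝓘(ℝ, EP) 2 P := .of_le (n := ∞) (by norm_cast)
  have : IsManifold 𝓘(ℝ, EQ) 2 Q := .of_le (n := ∞) (by norm_cast)
  have : IsManifold 𝓘(ℝ, EP) 1 P := .of_le (n := ∞) (by simp)
  have : IsManifold 𝓘(ℝ, EQ) 1 Q := .of_le (n := ∞) (by simp)
  refine differentiableVFieldAt_of_contMDiffAt ?_
  exact ContMDiffAt.mpullback_vectorField_preimage (n := 2)
    ((ContMDiff.contMDiffAt hZ).of_le (by simp)) (hΛ.contMDiff.contMDiffAt.of_le (by norm_cast))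
    (isInvertible_mfderiv_of_isLocalDiffeomorph hΛ p) (by norm_num)

end SpinLift

end KosmannSymmetry

/-! ### The theorem on adapted gauges. -/

open KosmannSymmetry in
theorem mainTheorem5 (d : ℕ)
    -- the spacetime `X` with a free smooth right action of an abelian Lie group `G`
    {EG : Type*} [NormedAddCommGroup EG] [NormedSpace ℝ EG] [FiniteDimensional ℝ EG]
    {G : Type*} [TopologicalSpace G] [ChartedSpace EG G] [CommGroup G]
    [LieGroup 𝓘(ℝ, EG) ∞ G]
    {EX : Type*} [NormedAddCommGroup EX] [NormedSpace ℝ EX] [FiniteDimensional ℝ EX]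
    {X : Type*} [TopologicalSpace X] [ChartedSpace EX X] [IsManifold 𝓘(ℝ, EX) ∞ X]
    [MulAction Gᵐᵒᵖ X]
    (hsmooth : ContMDiff (𝓘(ℝ, EX).prod 𝓘(ℝ, EG)) 𝓘(ℝ, EX) ∞ (fun a : X × G => rmul a.2 a.1))
    (hfree : ∀ (x : X) (g : G), rmul g x = x → g = 1)
    -- the `SO(1,d)`-structure `π : Q → X` and its coframe `e` with metric `g`
    {EQ : Type*} [NormedAddCommGroup EQ] [NormedSpace ℝ EQ] [FiniteDimensional ℝ EQ]
    {Q : Type*} [TopologicalSpace Q] [ChartedSpace EQ Q] [IsManifold 𝓘(ℝ, EQ) ∞ Q]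
    [MulAction (SO d)ᵐᵒᵖ Q]
    (π : Q → X) (hπ : IsPrincipalSOBundle d EX EQ π)
    (e : TensorField EQ Q 1 (Mink d)) (he : IsCoframe (EX := EX) π e)
    (g : TensorField EX X 2 ℝ) (hg : IsMetricOf π e g)
    -- the `Spin(1,d)`-lift, a spinor field and a spin connection
    {EP : Type*} [NormedAddCommGroup EP] [NormedSpace ℝ EP] [FiniteDimensional ℝ EP]
    {P : Type*} [TopologicalSpace P] [ChartedSpace EP P] [IsManifold 𝓘(ℝ, EP) ∞ P]
    [MulAction (Spin d)ᵐᵒᵖ P]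
    (Λ : P → Q) (hΛ : IsSpinLift d EQ EP π Λ)
    {V : Type*} [NormedAddCommGroup V] [NormedSpace ℝ V] [FiniteDimensional ℝ V]
    (τ : Representation ℝ (Spin d) V) (hτ : Continuous (fun a : Spin d × V => τ a.1 a.2))
    {k : ℕ} (ψ : TensorField EP P k V) (hψ : IsSpinorForm (EX := EX) π Λ τ ψ)
    (ω' : TensorField EP P 1 (Mink d →L[ℝ] Mink d))
    (hω : IsSpinConnection (EQ := EQ) Λ ω')
    -- all of them are `G`-symmetric for the Kosmann Lie derivative
    (hLe : ∀ A : GroupLieAlgebra 𝓘(ℝ, EG) G,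
      HasKosmannLieDerivCoframe π e g (fundamentalVField EX X A) 0)
    (hLψ : ∀ A : GroupLieAlgebra 𝓘(ℝ, EG) G,
      HasKosmannLieDeriv π e g Λ (fundamentalVField EX X A) ψ 0)
    (hLω : ∀ A : GroupLieAlgebra 𝓘(ℝ, EG) G,
      HasKosmannLieDeriv π e g Λ (fundamentalVField EX X A) ω' 0)
    -- an adapted gauge `σ` over `U`, that is one in which `L_{A^#} ê = 0`
    (U : Set X) (σ : X → P) (hσ : IsLocalGauge EX EP π Λ U σ)
    (hadapted : ∀ A : GroupLieAlgebra 𝓘(ℝ, EG) G, ∀ x ∈ U,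
      lieDeriv (fundamentalVField EX X A) (pullback (Λ ∘ σ) e) x = 0) :
    ∀ A : GroupLieAlgebra 𝓘(ℝ, EG) G, ∀ x ∈ U,
      lieDeriv (fundamentalVField EX X A) (pullback σ ψ) x = 0 ∧
      lieDeriv (fundamentalVField EX X A) (pullback σ ω') x = 0 ∧
      ∀ Z : VField EQ Q, IsKosmannLift π e g (fundamentalVField EX X A) Z →
        correctionTerm Λ ω' (fundamentalVField EX X A) Z σ x = 0 := by
  have hf : ContMDiffOn 𝓘(ℝ, EX) 𝓘(ℝ, EQ) ∞ (Λ ∘ σ) U :=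
    hΛ.localDiffeo.contMDiff.comp_contMDiffOn hσ.smooth
  have hσx : ∀ x ∈ U, ContMDiffAt 𝓘(ℝ, EX) 𝓘(ℝ, EP) ∞ σ x := fun x hx =>
    hσ.smooth.contMDiffAt (hσ.isOpen.mem_nhds hx)
  intro A
  -- Proved for every Kosmann lift, so that the lifts supplied separately by the hypotheses on `ψ`
  -- and `ω'` need no identification with each other.
  have hrel : ∀ Z : VField EQ Q, IsKosmannLift π e g (fundamentalVField EX X A) Z → ∀ x ∈ U,
      mfderiv 𝓘(ℝ, EX) 𝓘(ℝ, EP) σ x (fundamentalVField EX X A x) = spinLift Λ Z (σ x) := by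
    intro Z hZ x hx
    exact mfderiv_eq_spinLift hΛ.localDiffeo ((hσx x hx).mdifferentiableAt (by simp))
      (mfderiv_section_eq hπ he hσ.isOpen hf hσ.proj hZ.smooth hZ.smooth.differentiableVFieldAt
        hZ.proj (hZ.lieDeriv_coframe_eq_zero he (hLe A)) (hadapted A) hx)
  have hξ : ∀ Z : VField EQ Q, IsKosmannLift π e g (fundamentalVField EX X A) Z → ∀ x ∈ U,
      DifferentiableVFieldAt (fundamentalVField EX X A) x := fun Z hZ x hx =>
    differentiableVFieldAt_of_proj hπ.smooth_proj hσ.isOpen hf hσ.proj hZ.smooth hZ.proj hx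
  intro x hx
  have hU := hσ.isOpen.mem_nhds hx
  obtain ⟨Z₁, hZ₁, hL₁⟩ := hLψ A
  obtain ⟨Z₂, hZ₂, hL₂⟩ := hLω A
  refine ⟨?_, ?_, fun Z hZ => ?_⟩
  · exact lieDeriv_pullback_eq_zero (hσx x hx) (hψ.smooth.differentiableTensorAt _) (hξ Z₁ hZ₁ x hx)
      (differentiableVFieldAt_spinLift hΛ.localDiffeo hZ₁.smooth _)
      (Filter.mem_of_superset hU (hrel Z₁ hZ₁)) (hL₁ _)
  · exact lieDeriv_pullback_eq_zero (hσx x hx) (hω.smooth.differentiableTensorAt _) (hξ Z₂ hZ₂ x hx)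
      (differentiableVFieldAt_spinLift hΛ.localDiffeo hZ₂.smooth _)
      (Filter.mem_of_superset hU (hrel Z₂ hZ₂)) (hL₂ _)
  · rw [correctionTerm, ← hrel Z hZ x hx, sub_eq_zero]
    refine congrArg (ω' (σ x)) ?_
    rw [vec_one_eta (fun _ => _)]
    rfl
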